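/- For an integer $v \ge 1$, let $K_v$ be the complete graph with vertex set $\{0,1,\ldots,v-1\}$, and let the length of the edge between distinct vertices $x$ and $y$ be $\ell(x,y) = \min(|y-x|,\, v-|y-x|)$. A multiset $L$ of positive integers is \emph{realizable} (in $K_v$) if it is the multiset of lengths of the edges of some Hamiltonian path of $K_v$. The \emph{support} of $L$ is the set of its elements. For a finite set $S$ of integers, the \emph{Buratti--Horak--Rosa (BHR) Conjecture holds for the support $S$ at $v$} if every multiset $L$ of size $v-1$ with support $S$, where $S \subseteq \{1,2,\ldots,\lfloor v/2\rfloor\}$, satisfies: $L$ is realizable if and only if for every divisor $d$ of $v$ the number of multiples of $d$ in $L$, counted with multiplicity, is at most $v-d$. \textbf{Theorem.} Let $t \geq 1$ and $v$ be integers with $v \equiv 1$ or $v \equiv -1 \pmod{3t}$ and $v > 6t+53$. Then the BHR Conjecture holds for the support $\{1,3,3t\}$ at $v$. -/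

import Mathlib

/-- The length of the edge between `x` and `y` in the complete graph on `{0, 1, …, v - 1}`:
`min (|y - x|, v - |y - x|)`. The subtraction is exact, since `|y - x| < v`. -/
def edgeLength {v : ℕ} (x y : Fin v) : ℕ :=
  min ((y : ℤ) - (x : ℤ)).natAbs (v - ((y : ℤ) - (x : ℤ)).natAbs)

theorem edgeLength_comm {v : ℕ} (x y : Fin v) : edgeLength x y = edgeLength y x := by
  unfold edgeLength
  rw [← Int.natAbs_neg, neg_sub]

/-- The length as a function of unordered pairs of vertices. -/
def sym2Length {v : ℕ} : Sym2 (Fin v) → ℕ :=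
  Sym2.lift ⟨edgeLength, edgeLength_comm⟩

/-- `L` is realizable: it is the multiset of edge lengths of a Hamiltonian path in the complete
graph with vertex set `{0, 1, …, v - 1}`. -/
def IsRealizable (v : ℕ) (L : Multiset ℕ) : Prop :=
  ∃ (x y : Fin v) (p : (⊤ : SimpleGraph (Fin v)).Walk x y),
    p.IsHamiltonian ∧ (p.edges : Multiset (Sym2 (Fin v))).map sym2Length = L

/-- For every divisor `d` of `v`, the number of multiples of `d` in `L` (with multiplicity)
is at most `v - d`. -/
def DivisorCondition (v : ℕ) (L : Multiset ℕ) : Prop :=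
  ∀ d : ℕ, d ∣ v → L.countP (fun x => d ∣ x) + d ≤ v

/-- The Buratti-Horak-Rosa Conjecture holds for the support `S` at the number `v` of vertices:
a multiset of size `v - 1` with support `S`, contained in `{1, …, ⌊v / 2⌋}`, is realizable if and
only if it satisfies the divisor condition. -/
def BHRHoldsFor (v : ℕ) (S : Finset ℕ) : Prop :=
  ∀ L : Multiset ℕ, L.card + 1 = v → (∀ x ∈ L, 1 ≤ x ∧ x ≤ v / 2) → L.toFinset = S →
    (IsRealizable v L ↔ DivisorCondition v L)

/-!
Write `v = 3tk ± 1`. As `v` is coprime to `3t`, the divisor condition is void, so every multiset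
`{1ᵃ, 3ᵇ, (3t)ᶜ}` of size `v - 1` has to be realized. Multiplication by a unit `g` modulo `v`
permutes the vertices, so it is enough to find a Hamiltonian path on the interval `[0, v)` of
integers, without reduction modulo `v`, whose distances become the prescribed lengths after
multiplication by `g` (`LinPath.isRealizable`). Since `3t · k ≡ ∓1`, there are three ways to do so:

* `g = 1`, with distances `{1ᵃ, 3ᵇ, (3t)ᶜ}`;
* `g = 3`, with distances `{1ᵇ, tᶜ, (tk)ᵃ}`;
* `g = 3t`, with distances `{1ᶜ, kᵃ, (3k)ᵇ}`.

Paths on an interval come from the case of two distances: `{1ᵃ, yᶜ}` with `a ≥ y` is realized by a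
path that starts at the end of its interval (`exists_linPath_of_le`). The integers are arranged in
`y` columns according to their remainder modulo `y`; steps of length `y` go up and down in the
columns, and unit steps lead from a column to the next. Two such paths, one of them reflected, are
glued at their starting points, and so `{1ᵃ, xᵇ, yᶜ}` is realized whenever `a ≥ x + y`
(`exists_linPath_of_add_le`).

If this applies to none of the three forms, then `a < 3 + 3t`, `b < t + tk` and `c < 4k`, and the
sum of these bounds contradicts `a + b + c = v - 1` as soon as `(t - 2)(k - 2) ≥ 6`, which holds
for `t ≥ 3` since `v > 6t + 53`. For `t = 1` two distances are enough. For `t = 2` the remaining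
case is `{1ᵇ, 2ᶜ, (2k)ᵃ}` with `a ≤ 8`, where steps of length `2` can take the place of most
of the unit steps (`exists_linPath_two`).
-/

/-! ### Hamiltonian paths on sets of integers -/

/-- `LinPath S u w M`: the finite set `S` of integers can be listed without repetition as a
sequence from `u` to `w`, and `M` is the multiset of the distances of consecutive terms. -/
inductive LinPath : Set ℤ → ℤ → ℤ → Multiset ℕ → Prop
  | single (u : ℤ) : LinPath {u} u u 0
  | cons {S : Set ℤ} {u u' w : ℤ} {M : Multiset ℕ} :
      u ∉ S → LinPath S u' w M → LinPath (insert u S) u w ((u - u').natAbs ::ₘ M)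

namespace LinPath

variable {S T : Set ℤ} {u w u' w' : ℤ} {M M' : Multiset ℕ}

theorem left_mem (h : LinPath S u w M) : u ∈ S := by
  cases h <;> simp

theorem right_mem (h : LinPath S u w M) : w ∈ S := by
  induction h with
  | single u => simp
  | cons _ _ ih => exact Set.mem_insert_of_mem _ ih

theorem cast (h : LinPath S u w M) (hS : ∀ z, z ∈ T ↔ z ∈ S) (hu : u' = u) (hw : w' = w)
    (hM : M' = M) : LinPath T u' w' M' := by
  obtain rfl : T = S := Set.ext hS
  subst hu hw hM
  exact h

/-- Two paths can be joined at a common end, provided they meet nowhere else. -/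
theorem glue (h : LinPath S u w M) (h' : LinPath T w w' M') (hST : ∀ z ∈ S, z ∈ T → z = w) :
    LinPath (S ∪ T) u w' (M + M') := by
  induction h with
  | single u => exact h'.cast (by simp [h'.left_mem]) rfl rfl (by simp)
  | @cons S u u₁ w M hu h ih =>
    have hT : u ∉ T := fun hT => by
      have := hST u (Set.mem_insert _ _) hT
      exact hu (this ▸ h.right_mem)
    refine (LinPath.cons (u := u) ?_
      (ih h' fun z hz => hST z (Set.mem_insert_of_mem _ hz))).cast ?_ rfl rfl ?_
    · simp [hu, hT]
    · intro z; rw [Set.insert_union]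
    · simp

theorem pair (h : u ≠ w) : LinPath {u, w} u w {(u - w).natAbs} :=
  (LinPath.cons (by simpa using h) (.single w)).cast (by simp) rfl rfl (by simp)

/-- Two disjoint paths can be joined by an edge. -/
theorem append (h : LinPath S u w M) (h' : LinPath T u' w' M') (hST : ∀ z ∈ S, z ∉ T) :
    LinPath (S ∪ T) u w' (M + M' + {(w - u').natAbs}) := by
  refine (h.glue (LinPath.cons (hST w h.right_mem) h') ?_).cast ?_ rfl rfl ?_
  · rintro z hz (rfl | hz')
    · rfl
    · exact absurd hz' (hST z hz)
  · intro z
    have := h.right_mem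
    simp only [Set.mem_union, Set.mem_insert_iff]
    grind
  · rw [← Multiset.singleton_add]; abel

theorem reverse (h : LinPath S u w M) : LinPath S w u M := by
  induction h with
  | single u => exact .single u
  | @cons S u u₁ w M hu h ih =>
    have hne : u₁ ≠ u := fun e => hu (e ▸ h.left_mem)
    refine (ih.glue (pair hne) ?_).cast ?_ rfl rfl ?_
    · rintro z hz (rfl | rfl)
      · rfl
      · exact absurd hz hu
    · intro z
      have := h.left_mem
      simp only [Set.mem_union, Set.mem_insert_iff, Set.mem_singleton_iff]
      grind
    · rw [← Multiset.singleton_add, add_comm, ← Int.natAbs_neg, neg_sub]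

theorem translate (h : LinPath S u w M) (τ : ℤ) :
    LinPath {z | z - τ ∈ S} (u + τ) (w + τ) M := by
  induction h with
  | single u => exact (LinPath.single (u + τ)).cast (by simp [sub_eq_iff_eq_add]) rfl rfl rfl
  | @cons S u u₁ w M hu h ih =>
    refine (LinPath.cons (u := u + τ) ?_ ih).cast ?_ rfl rfl ?_
    · simpa using hu
    · intro z; simp [sub_eq_iff_eq_add]
    · congr 2; ring

theorem reflect (h : LinPath S u w M) (τ : ℤ) :
    LinPath {z | τ - z ∈ S} (τ - u) (τ - w) M := by
  induction h with
  | single u =>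
    refine (LinPath.single (τ - u)).cast (fun z => ?_) rfl rfl rfl
    simp only [Set.mem_ofPred_eq, Set.mem_singleton_iff]; omega
  | @cons S u u₁ w M hu h ih =>
    refine (LinPath.cons (u := τ - u) ?_ ih).cast ?_ rfl rfl ?_
    · simpa using hu
    · intro z
      simp only [Set.mem_ofPred_eq, Set.mem_insert_iff]
      have : τ - z = u ↔ z = τ - u := by omega
      rw [this]
    · congr 1; omega

end LinPath

open Multiset in
/-- The multiset `{1ᵃ, xᵇ, yᶜ}`. -/
def mix (x y a b c : ℕ) : Multiset ℕ := replicate a 1 + replicate b x + replicate c y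

theorem mix_add (x y a b c a' b' c' : ℕ) :
    mix x y a b c + mix x y a' b' c' = mix x y (a + a') (b + b') (c + c') := by
  simp only [mix, Multiset.replicate_add]; abel

theorem mix_swap (x y a b c : ℕ) : mix x y a b c = mix y x a c b := by
  simp only [mix]; abel

theorem singleton_one_eq_mix (x y : ℕ) : ({1} : Multiset ℕ) = mix x y 1 0 0 := by simp [mix]

theorem singleton_fst_eq_mix (x y : ℕ) : ({x} : Multiset ℕ) = mix x y 0 1 0 := by simp [mix]

theorem singleton_snd_eq_mix (x y : ℕ) : ({y} : Multiset ℕ) = mix x y 0 0 1 := by simp [mix]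

/-- A run of unit steps from `α` to `α + n`. -/
theorem LinPath.run (x y : ℕ) (α : ℤ) (n : ℕ) :
    LinPath (Set.Icc α (α + n)) α (α + n) (mix x y n 0 0) := by
  induction n generalizing α with
  | zero => exact (LinPath.single α).cast (by simp) rfl (by simp) (by simp [mix])
  | succ n ih =>
    refine ((LinPath.cons (u := α) ?_ (ih (α + 1)))).cast ?_ rfl ?_ ?_
    · simp
    · intro z; simp only [Set.mem_insert_iff, Set.mem_Icc]; push_cast; omega
    · push_cast; ring
    · rw [← Multiset.singleton_add]
      have : (α - (α + 1)).natAbs = 1 := by omega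
      rw [this, singleton_one_eq_mix x y, mix_add]
      congr 1; omega

/-- Unit steps can be put in front of a path that starts at the least vertex. -/
theorem LinPath.prefix_run {N : ℤ} {w : ℤ} {x y a b c : ℕ}
    (h : LinPath (Set.Ico 0 N) 0 w (mix x y a b c)) (p : ℕ) :
    ∃ w', LinPath (Set.Ico 0 (N + p)) 0 w' (mix x y (a + p) b c) := by
  refine ⟨w + p, ((run x y 0 p).glue ((h.translate p).cast (T := Set.Ico (p : ℤ) (N + p))
    (u' := 0 + (p : ℤ)) ?_ ?_ rfl rfl) ?_).cast ?_ rfl rfl ?_⟩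
  · intro z; simp only [Set.mem_Ico, Set.mem_ofPred_eq]; omega
  · rfl
  · intro z; simp only [Set.mem_Icc, Set.mem_Ico]; omega
  · have := h.left_mem
    intro z; simp only [Set.mem_union, Set.mem_Icc, Set.mem_Ico] at *; omega
  · rw [mix_add]; congr 1 <;> omega

/-- Two paths that start at the least vertex, the first of them reflected, share that vertex. -/
theorem LinPath.join {x y a b c a' b' c' n n' : ℕ} {w w' : ℤ}
    (h : LinPath (Set.Ico 0 (n + 1)) 0 w (mix x y a b c))
    (h' : LinPath (Set.Ico 0 (n' + 1)) 0 w' (mix x y a' b' c')) :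
    ∃ u₀ w₀, LinPath (Set.Ico 0 (n + n' + 1)) u₀ w₀ (mix x y (a + a') (b + b') (c + c')) := by
  have h₁ := (h.reflect n).reverse.cast (T := Set.Icc 0 n) (w' := (0 + n : ℤ)) ?_ rfl ?_ rfl
  have h₂ := (h'.translate n).cast (T := Set.Ico (n : ℤ) (n + n' + 1)) ?_ rfl rfl rfl
  · refine ⟨_, _, (h₁.glue h₂ ?_).cast ?_ rfl rfl (mix_add ..).symm⟩
    · intro z; simp only [Set.mem_Icc, Set.mem_Ico]; omega
    · intro z; simp only [Set.mem_union, Set.mem_Icc, Set.mem_Ico]; omega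
  · intro z; simp only [Set.mem_Ico, Set.mem_ofPred_eq]; omega
  · intro z; simp only [Set.mem_Icc, Set.mem_Ico, Set.mem_ofPred_eq]; omega
  · ring

/-! ### Two distances: the arrangement in columns -/

/-- The integers whose remainder modulo `y` lies in `[α, β)` and whose quotient lies in `[0, H)`:
in the arrangement of the integers in `y` columns, a block of columns of height `H`. -/
def box (y : ℕ) (α β H : ℤ) : Set ℤ :=
  {z | (α ≤ z % y ∧ z % y < β) ∧ (0 ≤ z / y ∧ z / y < H)}

theorem mem_box {y : ℕ} {α β H z : ℤ} :
    z ∈ box y α β H ↔ (α ≤ z % y ∧ z % y < β) ∧ (0 ≤ z / y ∧ z / y < H) := Iff.rfl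

theorem eq_add_mul_iff {y : ℕ} {r d : ℤ} (hr : 0 ≤ r) (hry : r < y) (z : ℤ) :
    z = r + y * d ↔ z % y = r ∧ z / y = d := by
  have := @Int.ediv_emod_unique z y r d (by omega)
  constructor
  · intro h; exact (this.2 ⟨h.symm, hr, hry⟩).symm
  · intro h; exact (this.1 h.symm).1.symm

/-- The interval `[0, qy + s)` in columns: `s` columns of height `q + 1` and the others of
height `q`. -/
theorem mem_Ico_iff_columns {y : ℕ} {q s : ℤ} (hs : 0 ≤ s) (hsy : s ≤ y) (hy : 0 < y) (z : ℤ) :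
    z ∈ Set.Ico 0 (q * y + s) ↔
      (0 ≤ z % y ∧ z % y < y) ∧ 0 ≤ z / y ∧ (z / y < q ∨ z / y = q ∧ z % y < s) := by
  have hy' : (0 : ℤ) < y := by exact_mod_cast hy
  have h0 := Int.emod_nonneg z hy'.ne'
  have h1 := Int.emod_lt_of_pos z hy'
  have h2 := Int.emod_add_mul_ediv z y
  generalize z % y = r at *
  generalize z / y = d at *
  subst h2
  simp only [Set.mem_Ico]
  constructor
  · rintro ⟨h3, h4⟩
    refine ⟨⟨h0, h1⟩, ?_, ?_⟩
    · by_contra! hd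
      nlinarith
    · by_contra! hd
      obtain ⟨hd1, hd2⟩ := hd
      rcases hd1.eq_or_lt with h | h
      · subst h
        have := hd2 rfl
        nlinarith
      · nlinarith
  · rintro ⟨-, h3, h4 | ⟨rfl, h4⟩⟩
    · constructor <;> nlinarith
    · constructor <;> nlinarith

theorem LinPath.column {y : ℕ} {α : ℤ} (hα : 0 ≤ α) (hαy : α < y) (x n : ℕ) :
    LinPath (box y α (α + 1) (n + 1)) α (α + y * n) (mix x y 0 0 n) := by
  induction n with
  | zero =>
    refine (LinPath.single α).cast (fun z => ?_) rfl (by simp) (by simp [mix])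
    have := eq_add_mul_iff (d := 0) hα hαy z
    rw [mul_zero, add_zero] at this
    rw [Set.mem_singleton_iff, this, mem_box]
    generalize z % y = r; generalize z / y = d
    push_cast; omega
  | succ n ih =>
    have hS : ∀ z, z = α + y * (n + 1) ↔ z % y = α ∧ z / y = n + 1 :=
      fun z => eq_add_mul_iff hα hαy z
    refine (LinPath.cons (u := α + y * (n + 1)) ?_ ih.reverse).reverse.cast
      (fun z => ?_) rfl (by push_cast; rfl) ?_
    · intro h
      obtain ⟨h1, h2⟩ := (hS _).1 rfl
      rw [mem_box, h1, h2] at h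
      omega
    · rw [Set.mem_insert_iff, hS, mem_box, mem_box]
      generalize z % y = r; generalize z / y = d
      push_cast; omega
    · have : (α + y * (n + 1) - (α + y * n) : ℤ).natAbs = y := by
        rw [show (α + y * (n + 1) - (α + y * n) : ℤ) = y by ring]; simp
      rw [← Multiset.singleton_add, this, singleton_snd_eq_mix x y, mix_add]
      congr 1; omega

/-- The level at which a column of height `n + 1` ends: its top for `true`, its bottom for
`false`. -/
def level (n : ℕ) : Bool → ℤ
  | true => n
  | false => 0

/-- Going up and down alternately through `m + 1` consecutive columns of height `n + 1`. The first
column is entered at the level given by `b`, and the side on which the last one is left depends on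
the parity of `m`. -/
theorem LinPath.snake {y : ℕ} (x n m : ℕ) {α : ℤ} (hα : 0 ≤ α) (hαy : α + m < y) (b : Bool) :
    LinPath (box y α (α + m + 1) (n + 1)) (α + y * level n b)
      (α + m + y * level n (b ^^ decide (Even m))) (mix x y m 0 ((m + 1) * n)) := by
  induction m generalizing α b with
  | zero =>
    have h := LinPath.column (y := y) (α := α) hα (by omega) x n
    cases b
    · exact h.cast (by simp) (by simp [level]) (by simp [level]) (by simp)
    · exact h.reverse.cast (by simp) (by simp [level]) (by simp [level]) (by simp)
  | succ m ih =>
    have h : LinPath (box y α (α + 1) (n + 1)) (α + y * level n b) (α + y * level n (!b))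
        (mix x y 0 0 n) := by
      have h := LinPath.column (y := y) (α := α) hα (by push_cast at hαy; omega) x n
      cases b
      · exact h.cast (by simp) (by simp [level]) (by simp [level]) (by simp)
      · exact h.reverse.cast (by simp) (by simp [level]) (by simp [level]) (by simp)
    refine (h.append (ih (α := α + 1) (by omega) (by push_cast at hαy; omega) (!b)) ?_).cast
      ?_ rfl ?_ ?_
    · intro z
      rw [mem_box, mem_box]
      generalize z % y = r; generalize z / y = d
      omega
    · intro z
      rw [Set.mem_union, mem_box, mem_box, mem_box]
      generalize z % y = r; generalize z / y = d
      push_cast; omega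
    · have : (b ^^ decide (Even (m + 1))) = (!b ^^ decide (Even m)) := by
        by_cases hm : Even m <;> simp [Nat.even_add_one, hm]
      rw [this]; push_cast; ring
    · rw [show (α + y * level n (!b) - (α + 1 + y * level n (!b)) : ℤ).natAbs = 1 by omega,
        singleton_one_eq_mix x y, mix_add, mix_add]
      congr 1
      · omega
      · ring

section Snakes

variable {y n : ℕ} {α β : ℤ}

/-- Ascending through an odd number of columns, from the bottom to the top. -/
theorem LinPath.snake_odd (x : ℕ) {k m c : ℕ} (hk : Odd k) (hα : 0 ≤ α) (hβ : β = α + k)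
    (hβy : β ≤ y) (hm : m + 1 = k) (hc : c = k * n) :
    LinPath (box y α β (n + 1)) α (β - 1 + y * n) (mix x y m 0 c) := by
  subst hm hβ hc
  have hm : Even m := by grind
  refine (LinPath.snake x n m (α := α) hα (by push_cast at hβy; omega) false).cast ?_ ?_ ?_ rfl
  · intro z; push_cast; rw [add_assoc]
  · simp [level]
  · simp [level, hm]; ring

/-- Ascending through an even number of columns, from the bottom to the bottom. -/
theorem LinPath.snake_even (x : ℕ) {k m c : ℕ} (hk : Even k) (hα : 0 ≤ α) (hβ : β = α + k)
    (hβy : β ≤ y) (hm : m + 1 = k) (hc : c = k * n) :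
    LinPath (box y α β (n + 1)) α (β - 1) (mix x y m 0 c) := by
  subst hm hβ hc
  have hm : ¬ Even m := by grind
  refine (LinPath.snake x n m (α := α) hα (by push_cast at hβy; omega) false).cast ?_ ?_ ?_ rfl
  · intro z; push_cast; rw [add_assoc]
  · simp [level]
  · simp [level, hm]; ring

end Snakes

/-- If `s = c % y` is even, the path runs through the `s` tall columns, returns to the bottom, and
then runs through the others. -/
theorem exists_linPath_of_even {x y q s : ℕ} (hs : Even s) (hsy : s < y) :
    ∃ w, LinPath (Set.Ico 0 (((q + 1 : ℕ) : ℤ) * y + s)) 0 w (mix x y (y - 1) 0 (q * y + s)) := by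
  have hI := mem_Ico_iff_columns (y := y) (q := (q + 1 : ℕ)) (s := s) (by omega) (by omega)
    (by omega)
  have h₂ := LinPath.snake (y := y) x q (y - s - 1) (α := s) (by omega) (by omega) false
  rcases Nat.eq_zero_or_pos s with rfl | hs0
  · refine ⟨_, h₂.cast ?_ ?_ rfl ?_⟩
    · intro z; rw [hI, mem_box]
      generalize z % y = r; generalize z / y = d
      push_cast; omega
    · simp [level]
    · congr 1
      rw [Nat.sub_zero, Nat.sub_add_cancel (by omega)]; ring
  · have h₁ := LinPath.snake_even (y := y) (n := q + 1) (α := 0) (β := s) x hs le_rfl (by ring)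
      (by omega) (Nat.sub_add_cancel hs0) rfl
    refine ⟨_, (h₁.append h₂ ?_).cast ?_ rfl rfl ?_⟩
    · intro z; rw [mem_box, mem_box]
      generalize z % y = r; generalize z / y = d
      push_cast; omega
    · intro z; rw [hI, Set.mem_union, mem_box, mem_box]
      generalize z % y = r; generalize z / y = d
      push_cast; omega
    · rw [show ((s : ℤ) - 1 - (s + y * level q false)).natAbs = 1 by simp [level],
        singleton_one_eq_mix x y, mix_add, mix_add]
      congr 1
      · omega
      · obtain ⟨e, rfl⟩ : ∃ e, y = s + e + 1 := ⟨y - s - 1, by omega⟩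
        rw [show s + e + 1 - s - 1 = e by omega]; ring

/-- If `s = c % y` and `y - s` are odd, or if `s = 1`, the path goes up in column `0`, then through
the columns `y - 1, …, s`, and at last through the columns `s - 1, …, 1`. -/
theorem exists_linPath_of_odd {x y q s : ℕ} (hs : Odd s) (hsy : s < y) (h : s = 1 ∨ Even y) :
    ∃ w, LinPath (Set.Ico 0 (((q + 1 : ℕ) : ℤ) * y + s)) 0 w (mix x y (y - 1) 0 (q * y + s)) := by
  have hI := mem_Ico_iff_columns (y := y) (q := (q + 1 : ℕ)) (s := s) (by omega) (by omega)
    (by omega)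
  have h₁ := LinPath.column (y := y) (α := 0) le_rfl (by omega) x (q + 1)
  have hlink : (0 + (y : ℤ) * ((q + 1 : ℕ) : ℤ) - ((y : ℤ) - 1 + y * q)).natAbs = 1 := by
    rw [show (0 + (y : ℤ) * ((q + 1 : ℕ) : ℤ) - ((y : ℤ) - 1 + y * q)) = 1 by push_cast; ring]; rfl
  rcases eq_or_ne s 1 with rfl | hs1
  -- For `s = 1` the path ends in column `1`, and the level `b` at which it ends is free.
  · obtain ⟨b, hb⟩ : ∃ b, (b ^^ decide (Even (y - 1 - 1))) = true :=
      ⟨!decide (Even (y - 1 - 1)), by simp⟩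
    have h₂ := LinPath.snake (y := y) x q (y - 1 - 1) (α := 1) (by omega) (by omega) b
    rw [hb] at h₂
    refine ⟨_, (h₁.append (h₂.reverse.cast (fun _ => Iff.rfl) (u' := (y : ℤ) - 1 + y * q)
      ?_ rfl rfl) ?_).cast ?_ rfl rfl ?_⟩
    · rw [level]; omega
    · intro z; rw [mem_box, mem_box]
      generalize z % y = r; generalize z / y = d
      push_cast; omega
    · intro z; rw [hI, Set.mem_union, mem_box, mem_box]
      generalize z % y = r; generalize z / y = d
      push_cast; omega
    · rw [hlink, singleton_one_eq_mix x y, mix_add, mix_add]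
      congr 1
      · omega
      · obtain ⟨e, rfl⟩ : ∃ e, y = e + 2 := ⟨y - 2, by omega⟩
        rw [show e + 2 - 1 - 1 = e by omega]; ring
  · have hy : Even y := h.resolve_left hs1
    have hs3 : 3 ≤ s := by obtain ⟨i, rfl⟩ := hs; omega
    have h₂ := LinPath.snake_odd (y := y) (n := q) (α := s) (β := y) x (k := y - s)
      (by grind) (by omega) (by omega) le_rfl (Nat.sub_add_cancel (by omega)) rfl
    have h₃ := LinPath.snake_even (y := y) (n := q + 1) (α := 1) (β := s) x (k := s - 1)
      (by grind) (by omega) (by omega) (by omega) (Nat.sub_add_cancel (by omega)) rfl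
    refine ⟨_, (h₁.append (h₂.reverse.append h₃.reverse ?_) ?_).cast ?_ rfl rfl ?_⟩
    · intro z; rw [mem_box, mem_box]
      generalize z % y = r; generalize z / y = d
      push_cast; omega
    · intro z; rw [Set.mem_union, mem_box, mem_box, mem_box]
      generalize z % y = r; generalize z / y = d
      push_cast; omega
    · intro z; rw [hI, Set.mem_union, Set.mem_union, mem_box, mem_box, mem_box]
      generalize z % y = r; generalize z / y = d
      push_cast; omega
    · rw [hlink, show ((s : ℤ) - (s - 1)).natAbs = 1 by omega, singleton_one_eq_mix x y]
      simp only [mix_add]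
      congr 1
      · omega
      · obtain ⟨e, rfl⟩ : ∃ e, y = s + e := ⟨y - s, by omega⟩
        obtain ⟨i, rfl⟩ : ∃ i, s = i + 1 := ⟨s - 1, by omega⟩
        simp only [Nat.add_sub_cancel, Nat.add_sub_cancel_left]; ring

/-- If `s = c % y ≥ 3` and `y` are odd, one more unit step is needed. It makes column `s` tall as
well; the path goes up in column `0`, then through the columns `y - 1, …, s + 1` and `s, …, 3`,
and covers the columns `2` and `1` together: over the top of column `2`, down in column `1`, and up
in the rest of column `2`. -/
theorem exists_linPath_of_odd_of_odd {x y q s : ℕ} (hs : Odd s) (hy : Odd y) (hs3 : 3 ≤ s)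
    (hsy : s < y) :
    ∃ w, LinPath (Set.Ico 0 (((q + 1 : ℕ) : ℤ) * y + (s + 1 : ℕ))) 0 w
      (mix x y y 0 (q * y + s)) := by
  have hsy' : s + 2 ≤ y := by grind
  have hI := mem_Ico_iff_columns (y := y) (q := (q + 1 : ℕ)) (s := (s + 1 : ℕ)) (by omega)
    (by omega) (by omega)
  have h₁ := LinPath.column (y := y) (α := 0) le_rfl (by omega) x (q + 1)
  have h₂ := LinPath.snake_odd (y := y) (n := q) (α := (s + 1 : ℕ)) (β := y) x (k := y - (s + 1))
    (by grind) (by omega) (by omega) le_rfl (Nat.sub_add_cancel (by omega)) rfl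
  have h₃ : LinPath _ (s : ℤ) ((y : ℤ) * (q + 1 : ℕ) + 3) _ :=
    (LinPath.snake (y := y) x (q + 1) (s - 3) (α := 3) (by omega) (by omega) true).reverse.cast
      (fun _ => Iff.rfl) (by
        have : Even (s - 3) := by grind
        simp [level, this]; omega) (by simp [level]; ring) rfl
  have h₄ := LinPath.single ((y : ℤ) * (q + 1 : ℕ) + 2)
  have h₅ := (LinPath.column (y := y) (α := 1) (by omega) (by omega) x (q + 1)).reverse
  have h₆ := LinPath.column (y := y) (α := 2) (by omega) (by omega) x q
  have htop : ∀ z : ℤ, z = (y : ℤ) * (q + 1 : ℕ) + 2 ↔ z % y = 2 ∧ z / y = (q + 1 : ℕ) := by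
    intro z
    rw [add_comm]
    exact eq_add_mul_iff (by omega) (by omega) z
  have hlink : (0 + (y : ℤ) * ((q + 1 : ℕ) : ℤ) - ((y : ℤ) - 1 + y * q)).natAbs = 1 := by
    rw [show (0 + (y : ℤ) * ((q + 1 : ℕ) : ℤ) - ((y : ℤ) - 1 + y * q)) = 1 by push_cast; ring]; rfl
  refine ⟨_, (h₁.append (h₂.reverse.append (h₃.append (h₄.append (h₅.append h₆ ?_) ?_) ?_) ?_)
    ?_).cast ?_ rfl rfl ?_⟩
  · intro z; rw [mem_box, mem_box]
    generalize z % y = r; generalize z / y = d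
    push_cast; omega
  · intro z; rw [Set.mem_singleton_iff, htop, Set.mem_union, mem_box, mem_box]
    generalize z % y = r; generalize z / y = d
    push_cast; omega
  · intro z; rw [Set.mem_union, Set.mem_union, Set.mem_singleton_iff, htop]
    simp only [mem_box]
    generalize z % y = r; generalize z / y = d
    push_cast; omega
  · intro z; rw [Set.mem_union, Set.mem_union, Set.mem_union, Set.mem_singleton_iff, htop]
    simp only [mem_box]
    generalize z % y = r; generalize z / y = d
    push_cast; omega
  · intro z
    rw [Set.mem_union, Set.mem_union, Set.mem_union, Set.mem_union, Set.mem_singleton_iff, htop]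
    simp only [mem_box]
    generalize z % y = r; generalize z / y = d
    push_cast; omega
  · intro z
    rw [hI, Set.mem_union, Set.mem_union, Set.mem_union, Set.mem_union, Set.mem_union,
      Set.mem_singleton_iff, htop]
    simp only [mem_box]
    generalize z % y = r; generalize z / y = d
    push_cast; omega
  · rw [hlink, show (((s + 1 : ℕ) : ℤ) - s).natAbs = 1 by omega,
      show ((1 : ℤ) - 2).natAbs = 1 by rfl,
      show ((y : ℤ) * (q + 1 : ℕ) + 2 - (1 + y * (q + 1 : ℕ))).natAbs = 1 by omega,
      show ((y : ℤ) * (q + 1 : ℕ) + 3 - (y * (q + 1 : ℕ) + 2)).natAbs = 1 by omega,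
      singleton_one_eq_mix x y, show (0 : Multiset ℕ) = mix x y 0 0 0 by simp [mix]]
    simp only [mix_add]
    congr 1
    · omega
    · obtain ⟨e, rfl⟩ : ∃ e, y = s + 2 + e := ⟨y - (s + 2), by omega⟩
      obtain ⟨i, rfl⟩ : ∃ i, s = i + 3 := ⟨s - 3, by omega⟩
      rw [show i + 3 + 2 + e - (i + 3 + 1) = e + 1 by omega, Nat.add_sub_cancel]; ring

/-- `{1ᵃ, yᶜ}` with `a ≥ y` is the multiset of distances of a Hamiltonian path on an interval that
starts at the least vertex. -/
theorem exists_linPath_of_le {x y a c : ℕ} (hy : 0 < y) (ha : y ≤ a) :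
    ∃ w, LinPath (Set.Ico 0 (((a + c : ℕ) : ℤ) + 1)) 0 w (mix x y a 0 c) := by
  -- `y - 1` or `y` unit steps lead through the columns, and the others are put in front.
  suffices ∃ e, e ≤ y ∧ ∃ w, LinPath (Set.Ico 0 (((e + c : ℕ) : ℤ) + 1)) 0 w (mix x y e 0 c) by
    obtain ⟨e, he, w, h⟩ := this
    obtain ⟨w', h'⟩ := h.prefix_run (a - e)
    refine ⟨w', h'.cast ?_ rfl rfl ?_⟩
    · intro z; simp only [Set.mem_Ico]; push_cast; omega
    · congr 1; omega
  obtain ⟨q, s, hsy, rfl⟩ : ∃ q s, s < y ∧ c = q * y + s :=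
    ⟨c / y, c % y, Nat.mod_lt _ hy, (Nat.div_add_mod' c y).symm⟩
  have hN : (((y - 1 + (q * y + s) : ℕ) : ℤ) + 1) = ((q + 1 : ℕ) : ℤ) * y + s := by
    push_cast [Nat.cast_sub (show 1 ≤ y from hy)]; ring
  have hN' : (((y + (q * y + s) : ℕ) : ℤ) + 1) = ((q + 1 : ℕ) : ℤ) * y + (s + 1 : ℕ) := by
    push_cast; ring
  rcases Nat.even_or_odd s with hs | hs
  · exact ⟨y - 1, by omega, hN ▸ exists_linPath_of_even hs hsy⟩
  by_cases h : s = 1 ∨ Even y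
  · exact ⟨y - 1, by omega, hN ▸ exists_linPath_of_odd hs hsy h⟩
  · push Not at h
    refine ⟨y, le_rfl, hN' ▸ exists_linPath_of_odd_of_odd hs (by grind) ?_ hsy⟩
    obtain ⟨i, rfl⟩ := hs
    omega

/-- `{1ᵃ, xᵇ, yᶜ}` with `a ≥ x + y` is the multiset of distances of a Hamiltonian path on an
interval. -/
theorem exists_linPath_of_add_le {x y a b c : ℕ} (hx : 0 < x) (hy : 0 < y) (ha : x + y ≤ a) :
    ∃ u w, LinPath (Set.Ico 0 ((a + b + c : ℕ) + 1)) u w (mix x y a b c) := by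
  obtain ⟨w, h⟩ := exists_linPath_of_le (x := y) (c := b) hx le_rfl
  obtain ⟨w', h'⟩ := exists_linPath_of_le (x := x) (a := a - x) (c := c) hy (by omega)
  rw [mix_swap] at h
  obtain ⟨u₀, w₀, h₀⟩ := h.join h'
  refine ⟨u₀, w₀, h₀.cast ?_ rfl rfl ?_⟩
  · intro z; simp only [Set.mem_Ico]; push_cast; omega
  · congr 1 <;> omega

/-! ### The distances 1, 2 and y -/

/-- Steps of length `2` go up through one parity class of an interval and down through the other,
between its two least vertices. -/
theorem LinPath.sweep (y n : ℕ) :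
    LinPath (Set.Ico 0 ((n : ℤ) + 2)) 1 0 (mix 2 y 1 n 0) := by
  induction n with
  | zero =>
    refine (LinPath.pair (u := 1) (w := 0) (by norm_num)).cast (fun z => ?_) rfl rfl
      (singleton_one_eq_mix 2 y).symm
    simp only [Set.mem_Ico, Set.mem_insert_iff, Set.mem_singleton_iff]; omega
  | succ n ih =>
    refine (LinPath.cons (u := 0) ?_ (ih.translate 1)).reverse.cast (fun z => ?_) rfl rfl ?_
    · simp
    · simp only [Set.mem_Ico, Set.mem_insert_iff, Set.mem_ofPred_eq]; push_cast; omega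
    · rw [← Multiset.singleton_add, show ((0 : ℤ) - (1 + 1)).natAbs = 2 by rfl,
        singleton_fst_eq_mix 2 y, mix_add]
      congr 1; omega

/-- The interval `[0, a)` together with `[y, y + a)`, in columns of height `2`. -/
theorem mem_box_two {y a : ℕ} (ha : a ≤ y) (z : ℤ) :
    z ∈ box y 0 a 2 ↔ (0 ≤ z ∧ z < a) ∨ (y ≤ z ∧ z < y + a) := by
  rw [mem_box]
  rcases Nat.eq_zero_or_pos y with rfl | hy
  · obtain rfl : a = 0 := by omega
    simp
  have hy' : (0 : ℤ) < y := by exact_mod_cast hy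
  have h0 := Int.emod_nonneg z hy'.ne'
  have h1 := Int.emod_lt_of_pos z hy'
  constructor
  · rintro ⟨⟨-, h2⟩, h3, h4⟩
    have h5 := Int.emod_add_mul_ediv z y
    obtain h6 | h6 : z / y = 0 ∨ z / y = 1 := by omega
    all_goals rw [h6] at h5; omega
  · rintro (⟨h2, h3⟩ | ⟨h2, h3⟩)
    · have := (eq_add_mul_iff (y := y) (r := z) (d := 0) (by omega) (by omega) z).1 (by ring)
      omega
    · have := (eq_add_mul_iff (y := y) (r := z - y) (d := 1) (by omega) (by omega) z).1 (by ring)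
      omega

/-- For even `a`, the `a` columns `{i, y + i}` are run through first, and steps of length `2` cover
what remains between them. -/
theorem exists_linPath_two_even {y a : ℕ} (ha : Even a) (ha0 : 0 < a) (hay : a + 3 ≤ y) :
    ∃ w, LinPath (Set.Ico 0 ((y : ℤ) + a)) 0 w (mix 2 y (a + 2) (y - a - 3) a) := by
  have h₁ := LinPath.snake_even (y := y) (n := 1) (α := 0) (β := a) 2 ha le_rfl (by ring)
    (by omega) (Nat.sub_add_cancel ha0) rfl
  obtain ⟨w, h₂⟩ := exists_linPath_of_le (x := y) (y := 2) (a := 2) (c := y - a - 3)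
    (by norm_num) le_rfl
  rw [mix_swap] at h₂
  refine ⟨_, (h₁.append (h₂.translate a) ?_).cast ?_ rfl rfl ?_⟩
  · intro z
    rw [show ((1 : ℕ) : ℤ) + 1 = 2 by rfl, mem_box_two (by omega)]
    simp only [Set.mem_Ico, Set.mem_ofPred_eq]; omega
  · intro z
    rw [show ((1 : ℕ) : ℤ) + 1 = 2 by rfl, Set.mem_union, mem_box_two (by omega)]
    simp only [Set.mem_Ico, Set.mem_ofPred_eq]; omega
  · rw [show ((a : ℤ) - 1 - (0 + a)).natAbs = 1 by omega, singleton_one_eq_mix 2 y, mix_add,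
      mix_add]
    congr 1 <;> omega

/-- For odd `a`, the path starts with the last of the columns `{i, y + i}`, sweeps the vertices
between the two rows, and comes back to run through the other columns. -/
theorem exists_linPath_two_odd {y a : ℕ} (ha : Odd a) (hay : a + 2 ≤ y) :
    ∃ w e c, e ≤ a ∧ e + c + 1 = y ∧
      LinPath (Set.Ico 0 ((y : ℤ) + a)) 0 w (mix 2 y e c a) := by
  suffices ∃ w e c, e ≤ a ∧ e + c + 1 = y ∧
      LinPath (Set.Ico 0 ((y : ℤ) + a)) (y + a - 1) w (mix 2 y e c a) by
    obtain ⟨w, e, c, he, hc, h⟩ := this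
    refine ⟨_, e, c, he, hc, (h.reflect (y + a - 1)).cast ?_ (by ring) rfl rfl⟩
    intro z; simp only [Set.mem_Ico, Set.mem_ofPred_eq]; omega
  have ha0 := ha.pos
  have h₁ : LinPath {((y : ℤ) + a - 1), ((a : ℤ) - 1)} (y + a - 1) (a - 1) (mix 2 y 0 0 1) := by
    refine (LinPath.pair (by omega)).cast (fun _ => Iff.rfl) rfl rfl ?_
    rw [← singleton_snd_eq_mix]; congr 1; omega
  have h₂ := (LinPath.sweep y (y - a - 2)).translate a
  have h₁₂ := h₁.append h₂ (by
    intro z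
    simp only [Set.mem_Ico, Set.mem_ofPred_eq, Set.mem_insert_iff, Set.mem_singleton_iff]; omega)
  rw [show ((a : ℤ) - 1 - (1 + a)).natAbs = 2 by omega, singleton_fst_eq_mix 2 y, mix_add,
    mix_add] at h₁₂
  rcases Nat.eq_zero_or_pos (a - 1) with ha1 | ha1
  · obtain rfl : a = 1 := by omega
    refine ⟨_, 1, y - 2, le_rfl, by omega, h₁₂.cast ?_ rfl rfl ?_⟩
    · intro z
      simp only [Set.mem_union, Set.mem_Ico, Set.mem_ofPred_eq, Set.mem_insert_iff,
        Set.mem_singleton_iff]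
      omega
    · congr 1; omega
  · have h₃ := (LinPath.snake_even (y := y) (n := 1) (α := 0) (β := (a - 1 : ℕ)) 2 (k := a - 1)
      (by grind) le_rfl (by ring) (by omega) (Nat.sub_add_cancel ha1) rfl).reverse
    refine ⟨_, a - 1, y - a, by omega, by omega, (h₁₂.append h₃ ?_).cast ?_ rfl rfl ?_⟩
    · intro z
      rw [show ((1 : ℕ) : ℤ) + 1 = 2 by rfl, mem_box_two (by omega)]
      simp only [Set.mem_union, Set.mem_Ico, Set.mem_ofPred_eq, Set.mem_insert_iff,
        Set.mem_singleton_iff]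
      omega
    · intro z
      rw [show ((1 : ℕ) : ℤ) + 1 = 2 by rfl, Set.mem_union, mem_box_two (by omega)]
      simp only [Set.mem_union, Set.mem_Ico, Set.mem_ofPred_eq, Set.mem_insert_iff,
        Set.mem_singleton_iff]
      omega
    · rw [show ((0 : ℤ) + a - ((a - 1 : ℕ) - 1)).natAbs = 2 by omega, singleton_fst_eq_mix 2 y,
        mix_add, mix_add]
      congr 1 <;> omega

/-- If there are few steps of length `y`, then many of the vertices between the two rows that they
join can be covered by steps of length `2`, so that few unit steps are enough. -/
theorem exists_linPath_two {y a b c : ℕ} (ha0 : 0 < a) (hay : a + 3 ≤ y) (hb : a + 4 ≤ b)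
    (hc : y ≤ c) :
    ∃ u w, LinPath (Set.Ico 0 ((b + c + a : ℕ) + 1)) u w (mix 2 y b c a) := by
  obtain ⟨w, e, c', he, hc', h⟩ : ∃ w e c', e ≤ a + 2 ∧ e + c' + 1 = y ∧
      LinPath (Set.Ico 0 ((y : ℤ) + a)) 0 w (mix 2 y e c' a) := by
    rcases Nat.even_or_odd a with h | h
    · obtain ⟨w, hw⟩ := exists_linPath_two_even h ha0 hay
      exact ⟨w, _, _, le_rfl, by omega, hw⟩
    · obtain ⟨w, e, c', he, hc', hw⟩ := exists_linPath_two_odd h (y := y) (by omega)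
      exact ⟨w, e, c', by omega, hc', hw⟩
  obtain ⟨w', h'⟩ := exists_linPath_of_le (x := y) (y := 2) (a := b - e) (c := c - c')
    (by norm_num) (by omega)
  rw [mix_swap] at h'
  obtain ⟨u₀, w₀, h₀⟩ := h'.join (n' := e + c' + a) (h.cast (by
    intro z; simp only [Set.mem_Ico]; push_cast; omega) rfl rfl rfl)
  refine ⟨u₀, w₀, h₀.cast ?_ rfl rfl ?_⟩
  · intro z; simp only [Set.mem_Ico]; push_cast; omega
  · congr 1 <;> omega

/-! ### From intervals to the complete graph -/

/-- The length of the edges whose ends differ by `±gℓ` modulo `v`. -/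
def cyclicLength (v g ℓ : ℕ) : ℕ := min (g * ℓ % v) (v - g * ℓ % v)

theorem cyclicLength_eq {v g ℓ d : ℕ} (hd : 0 < d) (hdv : 2 * d ≤ v)
    (h : ∃ j, g * ℓ = d + v * j ∨ g * ℓ + d = v * j) : cyclicLength v g ℓ = d := by
  obtain ⟨j, h | h⟩ := h
  · rw [cyclicLength, h, Nat.add_mul_mod_self_left, Nat.mod_eq_of_lt (by omega)]
    omega
  · obtain ⟨i, rfl⟩ : ∃ i, j = i + 1 := ⟨j - 1, by
      rcases j with _ | j
      · omega
      · rfl⟩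
    have : g * ℓ = (v - d) + v * i := by
      zify [show d ≤ v by omega] at h ⊢
      linarith
    rw [cyclicLength, this, Nat.add_mul_mod_self_left, Nat.mod_eq_of_lt (by omega)]
    omega

/-- The residues of `gi` and `gj` are joined by an edge whose length depends only on `|i - j|`. -/
theorem edgeLength_mul_mod {v g : ℕ} (hv : 0 < v) {x y : Fin v} {i j : ℤ}
    (hx : (x : ℤ) = g * i % v) (hy : (y : ℤ) = g * j % v) :
    edgeLength x y = cyclicLength v g (i - j).natAbs := by
  have hv' : (0 : ℤ) < v := by exact_mod_cast hv
  have hlt := Nat.mod_lt (g * (i - j).natAbs) hv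
  have hxl := x.2
  have hyl := y.2
  -- The difference of the two ends is congruent to `gℓ` or to `-gℓ`.
  have key : ∃ m : ℤ, (y : ℤ) - x = (g * (i - j).natAbs % v : ℕ) + v * m ∨
      (x : ℤ) - y = (g * (i - j).natAbs % v : ℕ) + v * m := by
    have h1 := Int.emod_add_mul_ediv (g * i) v
    have h2 := Int.emod_add_mul_ediv (g * j) v
    have h3 := Int.emod_add_mul_ediv (g * (i - j).natAbs) v
    push_cast at h3 ⊢
    rcases abs_choice (i - j) with h | h <;> rw [h] at h3 ⊢
    · exact ⟨g * (i - j) / v - g * i / v + g * j / v, Or.inr (by rw [hx, hy]; linarith)⟩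
    · exact ⟨g * -(i - j) / v + g * i / v - g * j / v, Or.inl (by rw [hx, hy]; linarith)⟩
  unfold edgeLength cyclicLength
  generalize g * (i - j).natAbs % v = r at *
  obtain ⟨m, hm⟩ := key
  obtain hm0 | hm0 | hm0 | hm0 : m ≤ -2 ∨ m = -1 ∨ m = 0 ∨ 1 ≤ m := by omega
  · have : (v : ℤ) * m ≤ v * (-2) := mul_le_mul_of_nonneg_left hm0 hv'.le
    omega
  · subst hm0; omega
  · subst hm0; omega
  · have : (v : ℤ) * 1 ≤ v * m := mul_le_mul_of_nonneg_left hm0 hv'.le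
    omega

/-- Multiplication by a unit `g` modulo `v` turns a Hamiltonian path on `[0, v)` into one in the
complete graph. -/
theorem LinPath.isRealizable {v g : ℕ} (hv : 0 < v) (hg : g.Coprime v) {u w : ℤ} {M : Multiset ℕ}
    (h : LinPath (Set.Ico 0 (v : ℤ)) u w M) : IsRealizable v (M.map (cyclicLength v g)) := by
  have hv' : (0 : ℤ) < v := by exact_mod_cast hv
  let φ : ℤ → Fin v := fun i =>
    ⟨(g * i % v).toNat, by
      have := Int.emod_nonneg (g * i) hv'.ne'
      have := Int.emod_lt_of_pos (g * i) hv'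
      omega⟩
  have hφ : ∀ i, ((φ i : ℕ) : ℤ) = g * i % v := fun i =>
    Int.toNat_of_nonneg (Int.emod_nonneg _ hv'.ne')
  have hinj : Set.InjOn φ (Set.Ico 0 (v : ℤ)) := by
    intro i hi j hj hij
    have h1 : (g : ℤ) * i ≡ g * j [ZMOD v] := by
      unfold Int.ModEq; rw [← hφ, ← hφ, hij]
    have h2 : i ≡ j [ZMOD v] := by
      have := Int.ModEq.cancel_left_div_gcd hv' h1
      rwa [Int.gcd_natCast_natCast, Nat.gcd_comm, hg.gcd_eq_one, Nat.cast_one,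
        Int.ediv_one] at this
    rw [Set.mem_Ico] at hi hj
    rwa [Int.ModEq, Int.emod_eq_of_lt hi.1 hi.2, Int.emod_eq_of_lt hj.1 hj.2] at h2
  have main : ∀ {S u w M}, LinPath S u w M → S ⊆ Set.Ico 0 (v : ℤ) →
      ∃ p : (⊤ : SimpleGraph (Fin v)).Walk (φ u) (φ w), p.IsPath ∧
        (∀ z, z ∈ p.support ↔ z ∈ φ '' S) ∧
        (p.edges : Multiset (Sym2 (Fin v))).map sym2Length = M.map (cyclicLength v g) := by
    intro S u w M h
    induction h with
    | single u => exact fun _ => ⟨.nil, by simp, by simp, by simp⟩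
    | @cons S u u' w M hu h ih =>
      intro hS
      obtain ⟨p, hp, hsupp, hM⟩ := ih fun z hz => hS (Set.mem_insert_of_mem _ hz)
      have hnot : φ u ∉ p.support := by
        rw [hsupp]
        rintro ⟨z, hz, hzu⟩
        have := hinj (hS (Set.mem_insert_of_mem _ hz)) (hS (Set.mem_insert _ _)) hzu
        exact hu (this ▸ hz)
      have hadj : (⊤ : SimpleGraph (Fin v)).Adj (φ u) (φ u') := by
        rw [SimpleGraph.top_adj]
        exact fun e => hnot (by rw [e]; exact p.start_mem_support)
      refine ⟨.cons hadj p, hp.cons hnot, ?_, ?_⟩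
      · intro z; rw [SimpleGraph.Walk.support_cons, List.mem_cons, hsupp, Set.image_insert_eq,
          Set.mem_insert_iff]
      · rw [SimpleGraph.Walk.edges_cons, ← Multiset.cons_coe, Multiset.map_cons, hM,
          Multiset.map_cons]
        congr 1
        exact edgeLength_mul_mod hv (hφ u) (hφ u')
  obtain ⟨p, hp, hsupp, hM⟩ := main h subset_rfl
  refine ⟨_, _, p, hp.isHamiltonian_of_mem fun z => (hsupp z).2 ?_, hM⟩
  -- An injective map between the `v` integers and the `v` vertices is onto.
  obtain ⟨i, hi⟩ := Finite.surjective_of_injective (f := fun i : Fin v => φ i) (fun i j hij =>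
    Fin.ext <| by
      exact_mod_cast hinj ⟨by omega, by exact_mod_cast i.2⟩ ⟨by omega, by exact_mod_cast j.2⟩ hij) z
  exact ⟨i, ⟨by omega, by exact_mod_cast i.2⟩, hi⟩

/-- The form in which paths with three distances are used: only the lengths that the three
distances turn into have to be known. -/
theorem isRealizable_of_linPath {v g x y d₁ d₂ d₃ a b c : ℕ} (hg : g.Coprime v)
    (hv : a + b + c + 1 = v)
    (h : ∃ u w, LinPath (Set.Ico 0 ((a + b + c : ℕ) + 1)) u w (mix x y a b c))
    (h₁ : cyclicLength v g 1 = d₁) (h₂ : cyclicLength v g x = d₂) (h₃ : cyclicLength v g y = d₃) :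
    IsRealizable v (Multiset.replicate a d₁ + Multiset.replicate b d₂ +
      Multiset.replicate c d₃) := by
  obtain ⟨u, w, h⟩ := h
  have hr := LinPath.isRealizable (v := v) (by omega) hg
    (h.cast (fun z => by rw [← hv]; push_cast; rfl) rfl rfl rfl)
  simpa [mix, h₁, h₂, h₃] using hr

theorem exists_eq_replicate {L : Multiset ℕ} {x y z : ℕ} (h : ∀ w ∈ L, w = x ∨ w = y ∨ w = z) :
    ∃ a b c, L = Multiset.replicate a x + Multiset.replicate b y + Multiset.replicate c z := by
  induction L using Multiset.induction_on with
  | empty => exact ⟨0, 0, 0, by simp⟩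
  | cons w L ih =>
    obtain ⟨a, b, c, rfl⟩ := ih fun w hw => h w (Multiset.mem_cons_of_mem hw)
    rcases h w (Multiset.mem_cons_self _ _) with rfl | rfl | rfl
    · exact ⟨a + 1, b, c, by simp [Multiset.replicate_succ]⟩
    · exact ⟨a, b + 1, c, by simp [Multiset.replicate_succ]⟩
    · exact ⟨a, b, c + 1, by simp [Multiset.replicate_succ]⟩

/-- The number of vertices is coprime to the lengths, so that only the divisor `1` matters. -/
theorem divisorCondition_of_coprime {v n : ℕ} {L : Multiset ℕ} (hL : L.card + 1 = v)
    (hn : n.Coprime v) (h : ∀ x ∈ L, x ∣ n) : DivisorCondition v L := by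
  intro d hd
  rcases eq_or_ne d 1 with rfl | hd1
  · have := Multiset.countP_le_card (fun x => 1 ∣ x) L
    omega
  · have h0 : L.countP (fun x => d ∣ x) = 0 := by
      rw [Multiset.countP_eq_zero]
      intro x hx hdx
      exact hd1 (Nat.eq_one_of_dvd_coprimes hn (hdx.trans (h x hx)) hd)
    have := Nat.le_of_dvd (by omega) hd
    omega

/-! ### The support `{1, 3, 3t}` -/

section Scaling

variable {t k v : ℕ}

/-- Unit steps become edges of length `1`. -/
theorem isRealizable_of_unit_one {a b c : ℕ} (ht : 0 < t) (hv2 : 2 * (3 * t) ≤ v)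
    (hL : a + b + c + 1 = v)
    (h : ∃ u w, LinPath (Set.Ico 0 ((a + b + c : ℕ) + 1)) u w (mix 3 (3 * t) a b c)) :
    IsRealizable v (Multiset.replicate a 1 + Multiset.replicate b 3 +
      Multiset.replicate c (3 * t)) :=
  isRealizable_of_linPath (g := 1) (Nat.coprime_one_left v) hL h
    (cyclicLength_eq (by omega) (by omega) ⟨0, .inl (by ring)⟩)
    (cyclicLength_eq (by omega) (by omega) ⟨0, .inl (by ring)⟩)
    (cyclicLength_eq (by omega) (by omega) ⟨0, .inl (by ring)⟩)

/-- Unit steps become edges of length `3`; then steps of length `tk` become edges of length `1`. -/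
theorem isRealizable_of_unit_three {a b c : ℕ} (ht : 0 < t)
    (hv : v = 3 * t * k + 1 ∨ v + 1 = 3 * t * k)
    (hco : (3 * t).Coprime v) (hv2 : 2 * (3 * t) ≤ v) (hL : a + b + c + 1 = v)
    (h : ∃ u w, LinPath (Set.Ico 0 ((b + c + a : ℕ) + 1)) u w (mix t (t * k) b c a)) :
    IsRealizable v (Multiset.replicate a 1 + Multiset.replicate b 3 +
      Multiset.replicate c (3 * t)) := by
  have := isRealizable_of_linPath (v := v) (g := 3) (d₁ := 3) (d₂ := 3 * t) (d₃ := 1)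
    hco.coprime_mul_right (by omega) h
    (cyclicLength_eq (by omega) (by omega) ⟨0, .inl (by ring)⟩)
    (cyclicLength_eq (by omega) (by omega) ⟨0, .inl (by ring)⟩)
    (cyclicLength_eq (by omega) (by omega) ⟨1, by
      rcases hv with hv | hv
      · right; linarith
      · left; linarith⟩)
  convert this using 1
  abel

/-- Unit steps become edges of length `3t`; then steps of length `k` and `3k` become edges of
length `1` and `3`. -/
theorem isRealizable_of_unit_three_mul {a b c : ℕ} (ht : 0 < t)
    (hv : v = 3 * t * k + 1 ∨ v + 1 = 3 * t * k)
    (hco : (3 * t).Coprime v) (hv2 : 2 * (3 * t) ≤ v) (hL : a + b + c + 1 = v)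
    (h : ∃ u w, LinPath (Set.Ico 0 ((c + a + b : ℕ) + 1)) u w (mix k (3 * k) c a b)) :
    IsRealizable v (Multiset.replicate a 1 + Multiset.replicate b 3 +
      Multiset.replicate c (3 * t)) := by
  have := isRealizable_of_linPath (v := v) (g := 3 * t) (d₁ := 3 * t) (d₂ := 1) (d₃ := 3)
    hco (by omega) h
    (cyclicLength_eq (by omega) (by omega) ⟨0, .inl (by ring)⟩)
    (cyclicLength_eq (by omega) (by omega) ⟨1, by
      rcases hv with hv | hv
      · right; linarith
      · left; linarith⟩)
    (cyclicLength_eq (by omega) (by omega) ⟨3, by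
      rcases hv with hv | hv
      · right; linarith
      · left; linarith⟩)
  convert this using 1
  abel

end Scaling

theorem exists_eq_mul_add_or {t v : ℕ}
    (hmod : (v : ℤ) ≡ 1 [ZMOD (3 * t : ℤ)] ∨ (v : ℤ) ≡ -1 [ZMOD (3 * t : ℤ)]) (hv : 0 < v) :
    ∃ k, v = 3 * t * k + 1 ∨ v + 1 = 3 * t * k := by
  rcases hmod with h | h
  · have h1 : ((3 * t : ℕ) : ℤ) ∣ (v - 1 : ℕ) := by
      push_cast [Nat.cast_sub hv]; exact h.symm.dvd
    obtain ⟨k, hk⟩ := Int.natCast_dvd_natCast.1 h1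
    exact ⟨k, .inl (by omega)⟩
  · have h1 : ((3 * t : ℕ) : ℤ) ∣ (v + 1 : ℕ) := by
      push_cast; simpa using h.symm.dvd
    obtain ⟨k, hk⟩ := Int.natCast_dvd_natCast.1 h1
    exact ⟨k, .inr hk⟩

theorem mainTheorem7 (t v : ℕ) (ht : 1 ≤ t)
    (hmod : (v : ℤ) ≡ 1 [ZMOD (3 * t : ℤ)] ∨ (v : ℤ) ≡ -1 [ZMOD (3 * t : ℤ)])
    (hv : 6 * t + 53 < v) :
    BHRHoldsFor v {1, 3, 3 * t} := by
  intro L hcard _ hsupp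
  have hmem : ∀ x, x ∈ L ↔ x = 1 ∨ x = 3 ∨ x = 3 * t := fun x => by
    rw [← Multiset.mem_toFinset, hsupp]; simp
  obtain ⟨k, hk⟩ := exists_eq_mul_add_or hmod (by omega)
  have hco : (3 * t).Coprime v := by
    rcases hk with rfl | hk
    · simp
    · have h : (3 * t * k).Coprime v := hk ▸ by simp
      exact h.coprime_mul_right
  refine iff_of_true ?_ (divisorCondition_of_coprime hcard hco fun x hx => ?_)
  swap
  · rcases (hmem x).1 hx with rfl | rfl | rfl <;> simp
  have h1 : 1 ∈ L := (hmem 1).2 (.inl rfl)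
  obtain ⟨a, b, c, rfl⟩ := exists_eq_replicate fun w hw => (hmem w).1 hw
  have ha : 0 < a := by
    by_contra! h
    obtain rfl : a = 0 := by omega
    simp only [Multiset.mem_add, Multiset.mem_replicate] at h1
    omega
  have hL : a + b + c + 1 = v := by simpa using hcard
  have hone := isRealizable_of_unit_one (a := a) (b := b) (c := c) ht (v := v) (by omega) hL
  have hthree := isRealizable_of_unit_three (a := a) (b := b) (c := c) ht hk hco (by omega) hL
  have hmul := isRealizable_of_unit_three_mul (a := a) (b := b) (c := c) ht hk hco (by omega) hL
  -- This is where the bound on `v` enters.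
  have hk2 : 18 ≤ t * (k - 2) ∧ 2 < k := by
    have h : 6 * t + 53 ≤ 3 * t * k := by omega
    have : 2 < k := by
      by_contra! h2
      have := Nat.mul_le_mul_left (3 * t) h2
      omega
    obtain ⟨e, rfl⟩ := Nat.exists_eq_add_of_lt this
    refine ⟨?_, this⟩
    rw [show 2 + e + 1 - 2 = e + 1 by omega]
    nlinarith
  obtain ⟨hk2, hk3⟩ := hk2
  obtain ⟨e, rfl⟩ : ∃ e, k = e + 2 := ⟨k - 2, by omega⟩
  rw [Nat.add_sub_cancel] at hk2
  by_cases hA : 3 + 3 * t ≤ a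
  · exact hone (exists_linPath_of_add_le (by omega) (by omega) hA)
  by_cases hC : e + 2 + 3 * (e + 2) ≤ c
  · exact hmul (exists_linPath_of_add_le (by omega) (by omega) hC)
  by_cases hB : t + t * (e + 2) ≤ b
  · exact hthree (exists_linPath_of_add_le ht (by positivity) hB)
  obtain rfl | rfl | ht3 : t = 1 ∨ t = 2 ∨ 3 ≤ t := by omega
  -- For `t = 1` the distances `3` and `3t` agree, as do `1` and `t` in the second form.
  · by_cases ha3 : 3 ≤ a
    · obtain ⟨w, h⟩ := exists_linPath_of_le (x := 3) (c := b + c) (by norm_num) ha3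
      refine hone ⟨0, w, h.cast (fun z => by rw [add_assoc]) rfl rfl ?_⟩
      simp only [mix, Multiset.replicate_add, Multiset.replicate_zero, mul_one]; abel
    · obtain ⟨w, h⟩ := exists_linPath_of_le (x := 1) (y := e + 2) (a := b + c) (c := a)
        (by omega) (by omega)
      refine hthree ⟨0, w, h.cast (fun _ => Iff.rfl) rfl rfl ?_⟩
      simp only [mix, Multiset.replicate_add, Multiset.replicate_zero, one_mul]; abel
  -- For `t = 2`, failure of the three bounds leaves `a ≤ 8`, `b ≥ a + 4` and `c ≥ 2k`.
  · refine hthree (exists_linPath_two ha (by omega) (by omega) (by omega))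
  · exfalso
    obtain ⟨s, rfl⟩ := Nat.exists_eq_add_of_le ht3
    have : 6 ≤ (s + 1) * e := by nlinarith
    have h3 : 3 * (3 + s) * (e + 2) ≤ a + b + c + 2 := by omega
    nlinarith
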